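/- Let $L_2=\langle a,t\mid a^2,\ [a^{t^i},a^{t^j}]\ (i,j\in\mathbb Z)\rangle$ be the lamplighter group (where $x^y=y^{-1}xy$), equipped with the word metric $d$ of the generating set $\{t,at\}$, and let $1$ be its identity. A geodesic ray is an isometric embedding $\gamma:\mathbb N\to L_2$ with $\gamma(0)=1$; two rays $\gamma,\gamma'$ are asymptotic if $\sup_n d(\gamma(n),\gamma'(n))<\infty$. The visual boundary $\partial_\infty L_2$ is the set of asymptotic classes of geodesic rays, with the quotient of the topology of uniform convergence on compact sets on the set of rays. The horofunction boundary is $\partial_h L_2=\overline{i(L_2)}\setminus i(L_2)$, a subspace of the space $C(L_2)$ of real-valued continuous functions on $L_2$ with the topology of uniform convergence on compact sets, where $i(z)(x)=d(z,x)-d(z,1)$. Then there is exactly one map $\beta:\partial_\infty L_2\to\partial_h L_2$ such that, for every geodesic ray $\gamma$, $\beta([\gamma])$ is the Busemann function $x\mapsto\lim_{n\to\infty}\bigl(d(\gamma(n),x)-d(\gamma(n),1)\bigr)$ of $\gamma$. The map $\beta$ is injective, and it is not continuous. Moreover, $\partial_\infty L_2$ is not Hausdorff, while $\partial_h L_2$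 is Hausdorff. -/

import Mathlib

open Filter Topology
open scoped commutatorElement

/-! ## Word metrics -/

/-- `l` is a word in the letters `S ∪ S⁻¹` which represents `g`. -/
def IsWordFor {G : Type*} [Group G] (S : Set G) (g : G) (l : List G) : Prop :=
  (∀ s ∈ l, s ∈ S ∨ s⁻¹ ∈ S) ∧ l.prod = g

/-- The word length of `g`: the least length of a word in `S ∪ S⁻¹` representing `g`
(meaningful when `S` generates `G`). -/
noncomputable def wordLength {G : Type*} [Group G] (S : Set G) (g : G) : ℕ :=
  sInf {n : ℕ | ∃ l : List G, IsWordFor S g l ∧ l.length = n}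

theorem wordLength_le {G : Type*} [Group G] {S : Set G} {g : G} {l : List G}
    (h : IsWordFor S g l) : wordLength S g ≤ l.length :=
  Nat.sInf_le ⟨l, h, rfl⟩

theorem exists_word {G : Type*} [Group G] {S : Set G} (hS : Subgroup.closure S = ⊤) (g : G) :
    ∃ l : List G, IsWordFor S g l ∧ l.length = wordLength S g := by
  have hg : g ∈ (Subgroup.closure S).toSubmonoid := by rw [hS]; trivial
  rw [Subgroup.closure_toSubmonoid] at hg
  obtain ⟨l, hl, hp⟩ := Submonoid.exists_list_of_mem_closure hg
  exact Nat.sInf_mem (s := {n : ℕ | ∃ l : List G, IsWordFor S g l ∧ l.length = n})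
    ⟨l.length, l, ⟨hl, hp⟩, rfl⟩

theorem wordLength_one {G : Type*} [Group G] (S : Set G) : wordLength S (1 : G) = 0 :=
  Nat.le_zero.mp (wordLength_le (l := []) ⟨by simp, rfl⟩)

theorem wordLength_inv_le {G : Type*} [Group G] {S : Set G} (hS : Subgroup.closure S = ⊤)
    (g : G) : wordLength S g⁻¹ ≤ wordLength S g := by
  obtain ⟨l, ⟨hl, hp⟩, hn⟩ := exists_word hS g
  rw [← hn]
  refine (wordLength_le (l := (l.map (·⁻¹)).reverse) ⟨?_, ?_⟩).trans (by simp)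
  · intro s hs
    simp only [List.mem_reverse, List.mem_map] at hs
    obtain ⟨u, hu, rfl⟩ := hs
    rw [inv_inv]
    exact (hl u hu).symm
  · rw [← List.prod_inv_reverse, hp]

theorem wordLength_mul_le {G : Type*} [Group G] {S : Set G} (hS : Subgroup.closure S = ⊤)
    (g h : G) : wordLength S (g * h) ≤ wordLength S g + wordLength S h := by
  obtain ⟨l, ⟨hl, hp⟩, hn⟩ := exists_word hS g
  obtain ⟨k, ⟨hk, hq⟩, hm⟩ := exists_word hS h
  rw [← hn, ← hm, ← List.length_append]
  refine wordLength_le ⟨?_, by rw [List.prod_append, hp, hq]⟩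
  intro s hs
  rcases List.mem_append.mp hs with h' | h'
  · exact hl s h'
  · exact hk s h'

theorem eq_one_of_wordLength_eq_zero {G : Type*} [Group G] {S : Set G}
    (hS : Subgroup.closure S = ⊤) {g : G} (hg : wordLength S g = 0) : g = 1 := by
  obtain ⟨l, ⟨_, hp⟩, hn⟩ := exists_word hS g
  rw [hg, List.length_eq_zero_iff] at hn
  rw [← hp, hn, List.prod_nil]

/-- The (left-invariant) word metric `d(g, h) = |g⁻¹ h|` of a generating set `S`, that is, the path
metric on the vertices of the Cayley graph with edges `g — g s`, `s ∈ S`. -/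
@[reducible]
noncomputable def wordMetricSpace {G : Type*} [Group G] (S : Set G)
    (hS : Subgroup.closure S = ⊤) : MetricSpace G where
  dist g h := (wordLength S (g⁻¹ * h) : ℝ)
  dist_self g := by simp [wordLength_one]
  dist_comm g h := by
    have h1 := wordLength_inv_le hS (g⁻¹ * h)
    have h2 := wordLength_inv_le hS (h⁻¹ * g)
    simp only [mul_inv_rev, inv_inv] at h1 h2
    exact_mod_cast le_antisymm h2 h1
  dist_triangle g h k := by
    have h1 := wordLength_mul_le hS (g⁻¹ * h) (h⁻¹ * k)
    have h2 : g⁻¹ * h * (h⁻¹ * k) = g⁻¹ * k := by group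
    rw [h2] at h1
    exact_mod_cast h1
  eq_of_dist_eq_zero {g h} hgh := by
    have h1 : wordLength S (g⁻¹ * h) = 0 := by exact_mod_cast hgh
    exact inv_mul_eq_one.mp (eq_one_of_wordLength_eq_zero hS h1)

/-! ## The lamplighter group `L₂` with its Diestel–Leader metric -/

/-- The two letters of the presentation of the lamplighter group. -/
inductive LampLetter : Type
  | a
  | t

/-- The relators `a²` and `[a^(t^i), a^(t^j)]`, `i j ∈ ℤ`, where `x^y = y⁻¹ x y`. -/
def lampRelators : Set (FreeGroup LampLetter) :=
  let a := FreeGroup.of LampLetter.a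
  let t := FreeGroup.of LampLetter.t
  {a ^ 2} ∪ {r | ∃ i j : ℤ, r = ⁅(t ^ i)⁻¹ * a * t ^ i, (t ^ j)⁻¹ * a * t ^ j⁆}

/-- The lamplighter group `L₂ = ⟨a, t ∣ a², [a^(t^i), a^(t^j)] for all i, j ∈ ℤ⟩`. -/
def Lamplighter : Type := PresentedGroup lampRelators

noncomputable instance : Group Lamplighter := inferInstanceAs (Group (PresentedGroup lampRelators))

/-- The generator `a` (toggle the lamp). -/
def lampA : Lamplighter := PresentedGroup.of (rels := lampRelators) LampLetter.a

/-- The generator `t` (step right). -/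
def lampT : Lamplighter := PresentedGroup.of (rels := lampRelators) LampLetter.t

/-- The generating set `S = {t, at}`. -/
def lampGenerators : Set Lamplighter := {lampT, lampA * lampT}

theorem closure_lampGenerators : Subgroup.closure lampGenerators = ⊤ := by
  have ht : lampT ∈ Subgroup.closure lampGenerators :=
    Subgroup.subset_closure (Or.inl rfl)
  have hat : lampA * lampT ∈ Subgroup.closure lampGenerators :=
    Subgroup.subset_closure (Or.inr rfl)
  have ha : lampA ∈ Subgroup.closure lampGenerators := by
    have := mul_mem hat (inv_mem ht)
    rwa [mul_inv_cancel_right] at this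
  have h : (⊤ : Subgroup Lamplighter) ≤ Subgroup.closure lampGenerators := by
    refine (PresentedGroup.closure_range_of lampRelators).symm.le.trans
      ((Subgroup.closure_le (G := Lamplighter) _).mpr ?_)
    rintro _ ⟨x, rfl⟩
    cases x
    · exact ha
    · exact ht
  exact top_le_iff.mp h

/-- `L₂` carries the word metric of `S = {t, at}`. -/
noncomputable instance : MetricSpace Lamplighter :=
  wordMetricSpace lampGenerators closure_lampGenerators

/-! ## The visual boundary -/

/-- The geodesic rays based at `b`: isometric embeddings `γ : ℕ → X` with `γ 0 = b`. The set of
rays carries the compact-open topology (uniform convergence on compact sets). -/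
abbrev GeodesicRay (X : Type*) [MetricSpace X] (b : X) : Type _ :=
  {γ : C(ℕ, X) // Isometry γ ∧ γ 0 = b}

/-- Two rays are asymptotic if they stay at bounded distance from each other. -/
def asymptoticSetoid (X : Type*) [MetricSpace X] (b : X) : Setoid (GeodesicRay X b) where
  r γ γ' := ∃ K : ℝ, ∀ n : ℕ, dist (γ.1 n) (γ'.1 n) ≤ K
  iseqv :=
    { refl := fun _ => ⟨0, fun _ => (dist_self _).le⟩
      symm := fun ⟨K, hK⟩ => ⟨K, fun n => (dist_comm _ _).trans_le (hK n)⟩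
      trans := fun ⟨K, hK⟩ ⟨K', hK'⟩ =>
        ⟨K + K', fun n => (dist_triangle _ _ _).trans (add_le_add (hK n) (hK' n))⟩ }

/-- The visual boundary `∂_∞ X`: asymptotic classes of geodesic rays based at `b`. -/
def VisualBoundary (X : Type*) [MetricSpace X] (b : X) : Type _ :=
  Quotient (asymptoticSetoid X b)

/-- The visual topology: the quotient of the compact-open topology on rays. -/
instance (X : Type*) [MetricSpace X] (b : X) : TopologicalSpace (VisualBoundary X b) :=
  inferInstanceAs (TopologicalSpace (Quotient (asymptoticSetoid X b)))

/-- The asymptotic class of a ray. -/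
def GeodesicRay.toBoundary {X : Type*} [MetricSpace X] {b : X} (γ : GeodesicRay X b) :
    VisualBoundary X b :=
  Quotient.mk (asymptoticSetoid X b) γ

/-! ## The horofunction boundary -/

/-- The embedding `i : X → C(X)`, `i(z)(x) = d(z, x) - d(z, b)`. -/
noncomputable def horoEmbedding {X : Type*} [MetricSpace X] (b z : X) : C(X, ℝ) where
  toFun x := dist z x - dist z b
  continuous_toFun := by fun_prop

/-- The horofunction boundary `∂_h X`: the closure of `i(X)` in `C(X)` minus `i(X)`, as a subspace
of `C(X)` with the compact-open topology. -/
abbrev HorofunctionBoundary (X : Type*) [MetricSpace X] (b : X) : Type _ :=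
  {h : C(X, ℝ) // h ∈ closure (Set.range (horoEmbedding b)) \ Set.range (horoEmbedding b)}

/-- `β` sends the class of every geodesic ray `γ` based at `b` to the Busemann function
`x ↦ lim_{n → ∞} (d(γ(n), x) - d(γ(n), b))` of `γ`. At most one map `β` has this property. -/
def IsBusemannMap {X : Type*} [MetricSpace X] {b : X}
    (β : VisualBoundary X b → HorofunctionBoundary X b) : Prop :=
  ∀ (γ : GeodesicRay X b) (x : X),
    Tendsto (fun n : ℕ => dist (γ.1 n) x - dist (γ.1 n) b) atTop
      (𝓝 ((β γ.toBoundary).1 x))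

/-! ## Horocyclic products -/

/-! With the generators `t` and `at` the Cayley graph is a horocyclic product of two trees. A lamp
state determines its position and, for each pair of elements, the height `lower` below which their
lamps agree and the height `upper` from which they agree. `dist_eq_treeDist` gives d = 2(upper -
lower) - |height difference|. Besides this formula, only the ultrametric inequalities for `lower`
and `upper` enter the study of rays.

A geodesic ray eventually climbs, or eventually descends, at unit speed (`ascending_or`); `reverse`
exchanges the two cases. Along a climbing ray the confluents with x stabilize, so d(γ k, x) =
height(γ k) + height x - 2α with α fixed. Hence Busemann limits exist and are attained. Evaluating
them along the ray itself shows that they determine its asymptotic class (`asymptotic_iff`), which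
makes β well defined and injective.

Two sequences of rays descend to height -m, light the lamp there and climb back; one of them also
keeps the lamp at -1 lit meanwhile. For each m the two rays finally coincide, so they are
asymptotic, but as m grows they converge to descending rays that differ forever at the lamp -1. Thus
the visual boundary is not Hausdorff. A continuous injection into the Hausdorff horofunction
boundary would make it so; hence β is not continuous. -/

/-- The data of a horocyclic product of two trees: a height function together with the heights of
the confluents of two points in the first tree (`lower`) and in the second tree (`upper`), which
determine the metric. -/
structure HorocyclicProduct (X : Type*) [MetricSpace X] where
  height : X → ℤ
  lower : X → X → ℤ
  upper : X → X → ℤ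
  lower_comm : ∀ x y, lower x y = lower y x
  upper_comm : ∀ x y, upper x y = upper y x
  lower_le : ∀ x y, lower x y ≤ height x
  le_upper : ∀ x y, height x ≤ upper x y
  lower_ultra : ∀ x y z, min (lower x y) (lower y z) ≤ lower x z
  upper_ultra : ∀ x y z, upper x z ≤ max (upper x y) (upper y z)
  dist_eq : ∀ x y, dist x y = ((2 * (upper x y - lower x y) - max (height x - height y) (height y - height x) : ℤ) : ℝ)

namespace HorocyclicProduct

variable {X : Type*} [MetricSpace X]

/-- Exchange the two trees. -/
def reverse (P : HorocyclicProduct X) : HorocyclicProduct X where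
  height x := -P.height x
  lower x y := -P.upper x y
  upper x y := -P.lower x y
  lower_comm x y := by rw [P.upper_comm]
  upper_comm x y := by rw [P.lower_comm]
  lower_le x y := neg_le_neg (P.le_upper x y)
  le_upper x y := neg_le_neg (P.lower_le x y)
  lower_ultra x y z := by have := P.upper_ultra x y z; omega
  upper_ultra x y z := by have := P.lower_ultra x y z; omega
  dist_eq x y := by
    rw [P.dist_eq]
    congr 1
    omega

theorem lower_le' (P : HorocyclicProduct X) (x y : X) : P.lower x y ≤ P.height y :=
  P.lower_comm x y ▸ P.lower_le y x

theorem le_upper' (P : HorocyclicProduct X) (x y : X) : P.height y ≤ P.upper x y :=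
  P.upper_comm x y ▸ P.le_upper y x

theorem lower_self (P : HorocyclicProduct X) (x : X) : P.lower x x = P.height x := by
  have h := P.dist_eq x x
  rw [dist_self, max_self] at h
  have h' : (0 : ℤ) = 2 * (P.upper x x - P.lower x x) - (P.height x - P.height x) := by exact_mod_cast h
  have := P.lower_le x x
  have := P.le_upper x x
  omega

theorem upper_self (P : HorocyclicProduct X) (x : X) : P.upper x x = P.height x := by
  have := P.reverse.lower_self x
  simpa [reverse] using this

theorem one_le_dist (P : HorocyclicProduct X) {x y : X} (h : x ≠ y) : 1 ≤ dist x y := by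
  have h0 := dist_pos.mpr h
  rw [P.dist_eq] at h0 ⊢
  exact_mod_cast h0

/-- Distances are integers. Consequently every function on X is continuous, and the compact-open
topology is that of pointwise convergence. -/
theorem discreteTopology (P : HorocyclicProduct X) : DiscreteTopology X :=
  DiscreteTopology.of_forall_le_dist one_pos fun _ _ h => P.one_le_dist h

/-! ### Geodesic rays in a horocyclic product -/

section Ray

variable {P : HorocyclicProduct X} {γ γ' : ℕ → X}

theorem ray_eq (hγ : Isometry γ) {i j : ℕ} (hij : i ≤ j) :
    2 * (P.upper (γ i) (γ j) - P.lower (γ i) (γ j)) - max (P.height (γ i) - P.height (γ j)) (P.height (γ j) - P.height (γ i))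
      = (j : ℤ) - i := by
  have h := P.dist_eq (γ i) (γ j)
  rw [hγ.dist_eq, dist_comm, Nat.dist_eq, abs_of_nonneg (by simpa using hij)] at h
  exact_mod_cast h.symm

/-- Since `upper - lower` is at least |height difference|, distance 1 bounds that difference by 1,
and parity makes it equal to 1. Both confluents are then extremal. -/
theorem ray_step (hγ : Isometry γ) (n : ℕ) :
    P.upper (γ n) (γ (n + 1)) = max (P.height (γ n)) (P.height (γ (n + 1))) ∧
      (P.height (γ (n + 1)) = P.height (γ n) + 1 ∨ P.height (γ (n + 1)) = P.height (γ n) - 1) := by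
  have h := ray_eq (P := P) hγ (Nat.le_succ n)
  have h1 := P.lower_le (γ n) (γ (n + 1))
  have h2 := P.lower_le' (γ n) (γ (n + 1))
  have h3 := P.le_upper (γ n) (γ (n + 1))
  have h4 := P.le_upper' (γ n) (γ (n + 1))
  simp only [Nat.succ_eq_add_one] at h
  push_cast at h
  omega

/-- Equality holds in the triangle inequality through γ j, so every ultrametric estimate used to
prove that inequality is sharp. -/
theorem ray_between (hγ : Isometry γ) {i j k : ℕ} (hij : i ≤ j) (hjk : j ≤ k) :
    P.upper (γ i) (γ j) ≤ P.upper (γ i) (γ k) ∧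
    min (P.upper (γ i) (γ j)) (P.upper (γ j) (γ k))
      ≤ max (P.height (γ j)) (min (P.height (γ i)) (P.height (γ k))) := by
  have e1 := ray_eq (P := P) hγ hij
  have e2 := ray_eq (P := P) hγ hjk
  have e3 := ray_eq (P := P) hγ (hij.trans hjk)
  have a1 := P.lower_le (γ i) (γ j)
  have a2 := P.lower_le' (γ i) (γ j)
  have a3 := P.lower_le (γ j) (γ k)
  have a4 := P.lower_le' (γ j) (γ k)
  have b1 := P.le_upper (γ i) (γ j)
  have b2 := P.le_upper' (γ i) (γ j)
  have b3 := P.le_upper (γ j) (γ k)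
  have b4 := P.le_upper' (γ j) (γ k)
  have u1 := P.lower_ultra (γ i) (γ j) (γ k)
  have u2 := P.upper_ultra (γ i) (γ j) (γ k)
  omega

/-- The height of the ray eventually increases at unit speed. -/
def Ascending (P : HorocyclicProduct X) (γ : ℕ → X) : Prop :=
  ∃ (N : ℕ) (c : ℤ), ∀ n ≥ N, P.height (γ n) = n + c

/-- At the first time the upper confluent with γ 0 exceeds K, the last step must itself have climbed
to that confluent. -/
theorem exists_first_above (hγ : Isometry γ) (hub : ∀ K : ℤ, ∃ n, K < P.upper (γ 0) (γ n))
    (K : ℤ) : ∃ n, K < P.upper (γ 0) (γ n) ∧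
      P.upper (γ 0) (γ n) = P.height (γ n) := by
  classical
  refine ⟨Nat.find (hub K), Nat.find_spec (hub K), ?_⟩
  have h1 := Nat.find_spec (hub K)
  have h2 : ∀ m < Nat.find (hub K), ¬ K < P.upper (γ 0) (γ m) := fun m hm => Nat.find_min _ hm
  generalize Nat.find (hub K) = n at h1 h2
  rcases n with _ | n
  · rw [P.upper_self]
  · have h3 := h2 n (Nat.lt_succ_self n)
    have h4 := (ray_step (P := P) hγ n).1
    have h5 := P.upper_ultra (γ 0) (γ n) (γ (n + 1))
    have h6 := P.le_upper' (γ 0) (γ n)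
    have h7 := P.le_upper' (γ 0) (γ (n + 1))
    omega

theorem ascending_of_upper_unbounded (hγ : Isometry γ)
    (hub : ∀ K : ℤ, ∃ n, K < P.upper (γ 0) (γ n)) : P.Ascending γ := by
  obtain ⟨N, hN, hN'⟩ := exists_first_above hγ hub (P.height (γ 0))
  have key : ∀ m : ℕ, P.upper (γ 0) (γ (N + m)) = P.height (γ (N + m)) ∧
      P.height (γ (N + m)) = P.height (γ N) + m := by
    intro m
    induction m with
    | zero => simpa using hN'
    | succ m ih =>
      obtain ⟨ih1, ih2⟩ := ih
      rw [← add_assoc]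
      generalize hn : N + m = n at ih1 ih2 ⊢
      obtain ⟨s1, s2⟩ := ray_step (P := P) hγ n
      have h5 := P.upper_ultra (γ 0) (γ n) (γ (n + 1))
      have h7 := P.le_upper' (γ 0) (γ (n + 1))
      rcases s2 with s2 | s2
      · push_cast
        omega
      -- A step down from γ n must be undone, because the ray later reaches a confluent above
      -- height(γ n). Then both upper confluents at γ (n + 1) are at least height(γ n), which
      -- exceeds height(γ (n + 1)) and height(γ 0), contrary to `ray_between`.
      · exfalso
        obtain ⟨k, hk, hk'⟩ := exists_first_above hγ hub (P.height (γ n))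
        have hnk : n + 1 ≤ k := by
          by_contra hlt
          have := (ray_between (P := P) hγ (Nat.zero_le k) (show k ≤ n by omega)).1
          omega
        have b1 := (ray_between (P := P) hγ (Nat.zero_le (n + 1)) hnk).2
        have b2 := (ray_between (P := P) hγ (Nat.zero_le n) (Nat.le_succ n)).1
        have b3 := P.le_upper' (γ (n + 1)) (γ k)
        simp only [Nat.succ_eq_add_one] at b2
        omega
  refine ⟨N, P.height (γ N) - N, fun n hn => ?_⟩
  obtain ⟨m, rfl⟩ := Nat.exists_eq_add_of_le hn
  rw [(key m).2]
  push_cast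
  ring

/-- If the upper confluents with γ 0 are bounded, the growth of the distance forces the lower ones
to -∞, which is the unbounded case for `reverse`. -/
theorem ascending_or (P : HorocyclicProduct X) (hγ : Isometry γ) :
    P.Ascending γ ∨ P.reverse.Ascending γ := by
  by_cases h : ∀ K : ℤ, ∃ n, K < P.upper (γ 0) (γ n)
  · exact Or.inl (ascending_of_upper_unbounded hγ h)
  · refine Or.inr (ascending_of_upper_unbounded hγ fun K => ?_)
    push Not at h
    obtain ⟨U, hU⟩ := h
    refine ⟨(2 * (U + K) + 1).toNat, ?_⟩
    have h1 := hU (2 * (U + K) + 1).toNat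
    have h2 := ray_eq (P := P) hγ (Nat.zero_le (2 * (U + K) + 1).toNat)
    change K < -P.lower _ _
    omega

theorem Ascending.lower_upper (hγ : Isometry γ) {N : ℕ} {c : ℤ}
    (hc : ∀ n ≥ N, P.height (γ n) = n + c) {i j : ℕ} (hi : N ≤ i) (hij : i ≤ j) :
    P.lower (γ i) (γ j) = i + c ∧ P.upper (γ i) (γ j) = j + c := by
  have e := ray_eq (P := P) hγ hij
  have h1 := hc i hi
  have h2 := hc j (hi.trans hij)
  have a1 := P.lower_le (γ i) (γ j)
  have b4 := P.le_upper' (γ i) (γ j)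
  omega

/-- Along an ascending ray the confluents with a point stabilize. -/
theorem Ascending.confluent (hγ : Isometry γ) (h : P.Ascending γ) (x : X) :
    ∃ α : ℤ, ∀ᶠ k in atTop, P.lower (γ k) x = α ∧ P.upper (γ k) x = P.height (γ k) := by
  obtain ⟨N, c, hc⟩ := h
  -- Beyond this index height(γ n) exceeds height x, hence every `lower (γ k) x`, so the ultrametric
  -- inequality leaves no room for the confluent to change.
  set n := max N (P.height x - c + 1).toNat with hn
  refine ⟨P.lower (γ n) x, ?_⟩
  filter_upwards [eventually_ge_atTop n, eventually_ge_atTop (P.upper (γ n) x - c).toNat]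
    with k hk hk'
  obtain ⟨l, u⟩ := Ascending.lower_upper hγ hc (show N ≤ n by omega) hk
  have h1 := hc k (by omega)
  have h2 := P.lower_ultra (γ n) (γ k) x
  have h3 := P.lower_ultra (γ k) (γ n) x
  have h4 := P.upper_ultra (γ k) (γ n) x
  have h5 := P.le_upper (γ k) x
  have h6 := P.lower_le' (γ n) x
  have h7 := P.lower_le' (γ k) x
  rw [P.lower_comm (γ k) (γ n)] at h3
  rw [P.upper_comm (γ k) (γ n)] at h4
  omega

theorem Ascending.eventually_height_ge (h : P.Ascending γ) (K : ℤ) :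
    ∀ᶠ k in atTop, K ≤ P.height (γ k) := by
  obtain ⟨N, c, hc⟩ := h
  filter_upwards [eventually_ge_atTop N, eventually_ge_atTop (K - c).toNat] with k hk hk'
  rw [hc k hk]
  omega

theorem Ascending.dist_eventually (hγ : Isometry γ) (h : P.Ascending γ) (x : X) :
    ∃ α : ℤ, ∀ᶠ k in atTop, P.lower (γ k) x = α ∧
      dist (γ k) x = ((P.height (γ k) + P.height x - 2 * α : ℤ) : ℝ) := by
  obtain ⟨α, hα⟩ := h.confluent hγ x
  refine ⟨α, ?_⟩
  filter_upwards [hα, h.eventually_height_ge (P.height x)] with k hk hk'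
  refine ⟨hk.1, ?_⟩
  rw [P.dist_eq, hk.1, hk.2]
  congr 1
  omega

theorem exists_busemann (P : HorocyclicProduct X) (hγ : Isometry γ) (x y : X) :
    ∃ v : ℝ, ∀ᶠ k in atTop, dist (γ k) x - dist (γ k) y = v := by
  rcases P.ascending_or hγ with h | h <;>
  · obtain ⟨α, hα⟩ := h.dist_eventually hγ x
    obtain ⟨α', hα'⟩ := h.dist_eventually hγ y
    obtain ⟨k₀, hk₀, hk₀'⟩ := (hα.and hα').exists
    refine ⟨dist (γ k₀) x - dist (γ k₀) y, ?_⟩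
    filter_upwards [hα, hα'] with k hk hk'
    rw [hk.2, hk'.2, hk₀.2, hk₀'.2]
    push_cast
    ring

theorem height_sub_le (P : HorocyclicProduct X) (x y : X) :
    ((max (P.height x - P.height y) (P.height y - P.height x) : ℤ) : ℝ) ≤ dist x y := by
  rw [P.dist_eq]
  have a1 := P.lower_le x y
  have a2 := P.lower_le' x y
  have b1 := P.le_upper x y
  have b2 := P.le_upper' x y
  have : max (P.height x - P.height y) (P.height y - P.height x) ≤
      2 * (P.upper x y - P.lower x y) - max (P.height x - P.height y) (P.height y - P.height x) := by omega
  exact_mod_cast this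

/-- Bounded distance keeps the lower confluent of γ k and γ' k within ⌈K⌉ of their heights. Once it
lies above z, both rays have the same lower confluent with z. -/
theorem Ascending.busemann_eq (hγ : Isometry γ) (hγ' : Isometry γ') (h : P.Ascending γ)
    (h' : P.Ascending γ') {K : ℝ} (hK : ∀ n, dist (γ n) (γ' n) ≤ K) (x y : X) :
    ∀ᶠ k in atTop, dist (γ k) x - dist (γ k) y = dist (γ' k) x - dist (γ' k) y := by
  have key : ∀ z : X, ∀ᶠ k in atTop, P.lower (γ k) z = P.lower (γ' k) z := by
    intro z
    filter_upwards [h.eventually_height_ge (P.height z + ⌈K⌉ + 1),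
      h'.eventually_height_ge (P.height z + ⌈K⌉ + 1)] with k h1 h2
    have h3 : ((2 * (P.upper (γ k) (γ' k) - P.lower (γ k) (γ' k)) -
        max (P.height (γ k) - P.height (γ' k)) (P.height (γ' k) - P.height (γ k)) : ℤ) : ℝ) ≤ (⌈K⌉ : ℝ) := by
      rw [← P.dist_eq]
      exact (hK k).trans (Int.le_ceil K)
    have h4 : 2 * (P.upper (γ k) (γ' k) - P.lower (γ k) (γ' k)) -
        max (P.height (γ k) - P.height (γ' k)) (P.height (γ' k) - P.height (γ k)) ≤ ⌈K⌉ := by exact_mod_cast h3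
    have a1 := P.lower_le (γ k) (γ' k)
    have a2 := P.lower_le' (γ k) (γ' k)
    have b1 := P.le_upper (γ k) (γ' k)
    have b2 := P.le_upper' (γ k) (γ' k)
    have c1 := P.lower_le' (γ k) z
    have c2 := P.lower_le' (γ' k) z
    have u1 := P.lower_ultra (γ k) (γ' k) z
    have u2 := P.lower_ultra (γ' k) (γ k) z
    rw [P.lower_comm (γ' k) (γ k)] at u2
    omega
  obtain ⟨α, hα⟩ := h.dist_eventually hγ x
  obtain ⟨β, hβ⟩ := h.dist_eventually hγ y
  obtain ⟨α', hα'⟩ := h'.dist_eventually hγ' x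
  obtain ⟨β', hβ'⟩ := h'.dist_eventually hγ' y
  filter_upwards [key x, key y, hα, hβ, hα', hβ'] with k k1 k2 k3 k4 k5 k6
  rw [k3.2, k4.2, k5.2, k6.2, ← k3.1, ← k4.1, ← k5.1, ← k6.1, k1, k2]
  push_cast
  ring

/-- Comparison at the point γ n puts the lower confluent of γ n with the far part of γ' at height(γ
n) up to a constant, hence that of γ n and γ' n as well, up to a constant. Their upper confluent
also stays near the two heights, so the distance is bounded. -/
theorem Ascending.asymptotic (hγ : Isometry γ) (hγ' : Isometry γ') (h : P.Ascending γ)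
    (h' : P.Ascending γ') {y : X}
    (heq : ∀ x, ∀ᶠ k in atTop, dist (γ k) x - dist (γ k) y = dist (γ' k) x - dist (γ' k) y) :
    ∃ K : ℝ, ∀ n, dist (γ n) (γ' n) ≤ K := by
  obtain ⟨β, hβ⟩ := h.dist_eventually hγ y
  obtain ⟨β', hβ'⟩ := h'.dist_eventually hγ' y
  obtain ⟨N, c, hc⟩ := h
  obtain ⟨N', c', hc'⟩ := h'
  set M := max N N'
  obtain ⟨K, hK⟩ : ∃ K : ℤ, ∀ n ≥ M, 2 * (P.upper (γ n) (γ' n) - P.lower (γ n) (γ' n)) ≤ K := by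
    refine ⟨2 * (max (P.upper (γ M) (γ' M)) 0 + 2 * max c (-c) + 2 * max c' (-c') + max (β' - β) (β - β')), fun n hn => ?_⟩
    obtain ⟨α, hα⟩ := Ascending.dist_eventually hγ ⟨N, c, hc⟩ (γ n)
    obtain ⟨α', hα'⟩ := Ascending.dist_eventually hγ' ⟨N', c', hc'⟩ (γ n)
    obtain ⟨k, k1, k2, k3, k4, k5, k6⟩ := ((heq (γ n)).and (hα.and (hα'.and (hβ.and (hβ'.and
      (eventually_ge_atTop n)))))).exists
    rw [k2.2, k3.2, k4.2, k5.2] at k1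
    have k1' : P.height (γ k) + P.height (γ n) - 2 * α - (P.height (γ k) + P.height y - 2 * β)
      = P.height (γ' k) + P.height (γ n) - 2 * α' - (P.height (γ' k) + P.height y - 2 * β') := by
      exact_mod_cast k1
    have l1 := (Ascending.lower_upper hγ hc (show N ≤ n by omega) k6).1
    have l2 := (Ascending.lower_upper hγ' hc' (show N' ≤ n by omega) k6).1
    have l3 := (Ascending.lower_upper hγ hc (show N ≤ M by omega) hn).2
    have l4 := (Ascending.lower_upper hγ' hc' (show N' ≤ M by omega) hn).2
    have l5 := P.lower_ultra (γ' n) (γ' k) (γ n)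
    have l6 := P.upper_ultra (γ n) (γ M) (γ' M)
    have l7 := P.upper_ultra (γ n) (γ' M) (γ' n)
    have l8 := k2.1
    have l9 := k3.1
    rw [P.lower_comm] at l8
    rw [P.lower_comm (γ' n) (γ n)] at l5
    rw [P.upper_comm (γ n) (γ M)] at l6
    omega
  refine ⟨max K (2 * M + dist (γ 0) (γ' 0)), fun n => ?_⟩
  rcases le_total M n with hn | hn
  · refine le_max_of_le_left ?_
    rw [P.dist_eq]
    have := hK n hn
    exact_mod_cast (show _ ≤ K by omega)
  · refine le_max_of_le_right ?_
    have h1 := dist_triangle4 (γ n) (γ 0) (γ' 0) (γ' n)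
    rw [hγ.dist_eq, hγ'.dist_eq, dist_comm (0 : ℕ) n, Nat.dist_eq, Nat.cast_zero, sub_zero,
      abs_of_nonneg (Nat.cast_nonneg n)] at h1
    have h2 : (n : ℝ) ≤ M := by exact_mod_cast hn
    linarith

theorem Ascending.not_asymptotic (h : P.Ascending γ) (h' : P.reverse.Ascending γ') {K : ℝ}
    (hK : ∀ n, dist (γ n) (γ' n) ≤ K) : False := by
  obtain ⟨k, k1, k2⟩ := ((h.eventually_height_ge (⌈K⌉ + 1)).and
    (h'.eventually_height_ge 0)).exists
  have h1 := (P.height_sub_le (γ k) (γ' k)).trans ((hK k).trans (Int.le_ceil K))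
  have h2 : max (P.height (γ k) - P.height (γ' k)) (P.height (γ' k) - P.height (γ k)) ≤ ⌈K⌉ := by exact_mod_cast h1
  change 0 ≤ -P.height (γ' k) at k2
  omega

/-- Along the climbing ray its own Busemann function tends to -∞, while that of the descending ray
is bounded below by height(γ n) up to a constant. -/
theorem Ascending.busemann_ne (hγ : Isometry γ) (hγ' : Isometry γ') (h : P.Ascending γ)
    (h' : P.reverse.Ascending γ') {y : X}
    (heq : ∀ x, ∀ᶠ k in atTop, dist (γ k) x - dist (γ k) y = dist (γ' k) x - dist (γ' k) y) :
    False := by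
  obtain ⟨β, hβ⟩ := h.dist_eventually hγ y
  obtain ⟨β', hβ'⟩ := h'.dist_eventually hγ' y
  have h0 := h
  obtain ⟨N, c, hc⟩ := h
  obtain ⟨n, n1, n2⟩ := ((h0.eventually_height_ge (β - β' - P.height y + 1)).and
    (eventually_ge_atTop N)).exists
  obtain ⟨α, hα⟩ := h0.dist_eventually hγ (γ n)
  obtain ⟨α', hα'⟩ := h'.dist_eventually hγ' (γ n)
  obtain ⟨k, k1, k2, k3, k4, k5, k6⟩ := ((heq (γ n)).and (hα.and (hα'.and (hβ.and (hβ'.and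
      (eventually_ge_atTop n)))))).exists
  rw [k2.2, k3.2, k4.2, k5.2] at k1
  have k1' : P.height (γ k) + P.height (γ n) - 2 * α - (P.height (γ k) + P.height y - 2 * β)
    = -P.height (γ' k) + -P.height (γ n) - 2 * α' -
      (-P.height (γ' k) + -P.height y - 2 * β') := by
    exact_mod_cast k1
  have l1 := (Ascending.lower_upper hγ hc n2 k6).1
  have l2 := hc n n2
  have l3 : P.reverse.lower (γ' k) (γ n) ≤ -P.height (γ n) := P.reverse.lower_le' _ _
  have l8 := k2.1
  have l9 := k3.1
  rw [P.lower_comm] at l8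
  rw [l9] at l3
  omega

/-- Asymptotic rays have the same Busemann function, and conversely. -/
theorem asymptotic_iff (P : HorocyclicProduct X) (hγ : Isometry γ) (hγ' : Isometry γ') (y : X) :
    (∃ K : ℝ, ∀ n, dist (γ n) (γ' n) ≤ K) ↔
      ∀ x, ∀ᶠ k in atTop, dist (γ k) x - dist (γ k) y = dist (γ' k) x - dist (γ' k) y := by
  constructor
  · rintro ⟨K, hK⟩ x
    rcases P.ascending_or hγ with h | h <;> rcases P.ascending_or hγ' with h' | h'
    · exact h.busemann_eq hγ hγ' h' hK x y
    · exact (h.not_asymptotic h' hK).elim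
    · exact (h'.not_asymptotic h fun n => dist_comm (γ n) (γ' n) ▸ hK n).elim
    · exact h.busemann_eq hγ hγ' h' hK x y
  · intro heq
    rcases P.ascending_or hγ with h | h <;> rcases P.ascending_or hγ' with h' | h'
    · exact h.asymptotic hγ hγ' h' heq
    · exact (h.busemann_ne hγ hγ' h' heq).elim
    · exact (h'.busemann_ne hγ' hγ h fun x => (heq x).mono fun _ => Eq.symm).elim
    · exact h.asymptotic hγ hγ' h' heq

end Ray

/-! ### The Busemann map -/

section Boundary

variable {b : X}

/-- The Busemann function of a geodesic ray. -/
noncomputable def busemann (P : HorocyclicProduct X) (γ : GeodesicRay X b) (x : X) : ℝ :=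
  (P.exists_busemann γ.2.1 x b).choose

theorem busemann_spec (P : HorocyclicProduct X) (γ : GeodesicRay X b) (x : X) :
    ∀ᶠ k in atTop, dist (γ.1 k) x - dist (γ.1 k) b = P.busemann γ x :=
  (P.exists_busemann γ.2.1 x b).choose_spec

theorem tendsto_busemann (P : HorocyclicProduct X) (γ : GeodesicRay X b) (x : X) :
    Tendsto (fun k => dist (γ.1 k) x - dist (γ.1 k) b) atTop (𝓝 (P.busemann γ x)) :=
  tendsto_nhds_of_eventually_eq (P.busemann_spec γ x)

theorem busemann_apply_ray (P : HorocyclicProduct X) (γ : GeodesicRay X b) (n : ℕ) :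
    P.busemann γ (γ.1 n) = -n := by
  obtain ⟨k, h1, h2⟩ := ((P.busemann_spec γ (γ.1 n)).and (eventually_ge_atTop n)).exists
  have h3 : dist (γ.1 k) b = k := by
    have h0 : dist (γ.1 k) b = dist (γ.1 k) (γ.1 0) := by rw [γ.2.2]
    rw [h0, γ.2.1.dist_eq, Nat.dist_eq, Nat.cast_zero, sub_zero,
      abs_of_nonneg (Nat.cast_nonneg k)]
  rw [← h1, h3, γ.2.1.dist_eq, Nat.dist_eq, abs_of_nonneg (by simpa using h2)]
  ring

theorem busemann_eq_iff (P : HorocyclicProduct X) (γ γ' : GeodesicRay X b) :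
    P.busemann γ = P.busemann γ' ↔ γ.toBoundary = γ'.toBoundary := by
  have h1 : γ.toBoundary = γ'.toBoundary ↔ ∃ K : ℝ, ∀ n, dist (γ.1 n) (γ'.1 n) ≤ K :=
    ⟨fun h => Quotient.exact h, fun h => Quotient.sound h⟩
  rw [h1, P.asymptotic_iff γ.2.1 γ'.2.1 b, funext_iff]
  refine forall_congr' fun x => ⟨fun h => ?_, fun h => ?_⟩
  · filter_upwards [P.busemann_spec γ x, P.busemann_spec γ' x] with k h1 h2
    rw [h1, h2, h]
  · obtain ⟨k, h1, h2, h3⟩ := ((P.busemann_spec γ x).and ((P.busemann_spec γ' x).and h)).exists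
    rw [← h1, ← h2, h3]

/-- The Busemann function of a ray as a point of the horofunction boundary. -/
noncomputable def horofunction (P : HorocyclicProduct X) (γ : GeodesicRay X b) :
    HorofunctionBoundary X b :=
  haveI := P.discreteTopology
  ⟨⟨P.busemann γ, continuous_of_discreteTopology⟩, by
    constructor
    · refine mem_closure_of_tendsto (f := fun k => horoEmbedding b (γ.1 k)) (b := atTop) ?_
        (Eventually.of_forall fun k => Set.mem_range_self _)
      rw [ContinuousMap.isHomeomorph_coe.isInducing.tendsto_nhds_iff, tendsto_pi_nhds]
      exact fun x => P.tendsto_busemann γ x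
    -- A function i(z) is bounded below by -d(z, b), whereas the Busemann function takes the value
    -- -n at γ n.
    · rintro ⟨z, hz⟩
      obtain ⟨n, hn⟩ := exists_nat_gt (dist z b)
      have h1 : dist z (γ.1 n) - dist z b = P.busemann γ (γ.1 n) :=
        DFunLike.congr_fun hz (γ.1 n)
      rw [P.busemann_apply_ray] at h1
      have := dist_nonneg (x := z) (y := γ.1 n)
      linarith⟩

/-- The Busemann map of a horocyclic product. -/
noncomputable def busemannMap (P : HorocyclicProduct X) (b : X) :
    VisualBoundary X b → HorofunctionBoundary X b :=
  Quotient.lift P.horofunction fun γ γ' h =>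
    Subtype.ext (DFunLike.coe_injective ((P.busemann_eq_iff γ γ').mpr (Quotient.sound h)))

theorem isBusemannMap_busemannMap (P : HorocyclicProduct X) (b : X) :
    IsBusemannMap (P.busemannMap b) :=
  fun γ x => P.tendsto_busemann γ x

theorem existsUnique_isBusemannMap (P : HorocyclicProduct X) (b : X) :
    ∃! β : VisualBoundary X b → HorofunctionBoundary X b, IsBusemannMap β := by
  refine ⟨P.busemannMap b, P.isBusemannMap_busemannMap b, fun β hβ => funext fun ξ => ?_⟩
  induction ξ using Quotient.inductionOn with
  | _ γ =>
    refine Subtype.ext (ContinuousMap.ext fun x => ?_)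
    exact tendsto_nhds_unique (hβ γ x) (P.tendsto_busemann γ x)

theorem injective_of_isBusemannMap (P : HorocyclicProduct X)
    {β : VisualBoundary X b → HorofunctionBoundary X b} (hβ : IsBusemannMap β) :
    Function.Injective β := by
  intro ξ ξ' h
  induction ξ using Quotient.inductionOn with
  | _ γ =>
  induction ξ' using Quotient.inductionOn with
  | _ γ' =>
  refine (P.busemann_eq_iff γ γ').mp (funext fun x => ?_)
  rw [← tendsto_nhds_unique (hβ γ x) (P.tendsto_busemann γ x),
    ← tendsto_nhds_unique (hβ γ' x) (P.tendsto_busemann γ' x)]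
  exact congrArg (fun h => h.1 x) h

end Boundary

end HorocyclicProduct

/-! ## The lamplighter group as a wreath product -/

/-- A configuration of lamps together with a position. -/
@[ext]
structure LampState where
  lamps : ℤ → ZMod 2
  pos : ℤ

namespace LampState

instance : Mul LampState := ⟨fun x y => ⟨fun i => x.lamps i + y.lamps (i - x.pos), x.pos + y.pos⟩⟩

instance : One LampState := ⟨⟨0, 0⟩⟩

instance : Inv LampState := ⟨fun x => ⟨fun i => -x.lamps (i + x.pos), -x.pos⟩⟩

@[simp] theorem mul_lamps (x y : LampState) (i : ℤ) :
    (x * y).lamps i = x.lamps i + y.lamps (i - x.pos) := rfl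

@[simp] theorem mul_pos (x y : LampState) : (x * y).pos = x.pos + y.pos := rfl

@[simp] theorem one_lamps (i : ℤ) : (1 : LampState).lamps i = 0 := rfl

@[simp] theorem one_pos : (1 : LampState).pos = 0 := rfl

@[simp] theorem inv_lamps (x : LampState) (i : ℤ) : x⁻¹.lamps i = -x.lamps (i + x.pos) := rfl

@[simp] theorem inv_pos (x : LampState) : x⁻¹.pos = -x.pos := rfl

instance : Group LampState :=
  Group.ofLeftAxioms
    (fun x y z => by
      ext i
      · simp [add_assoc, sub_sub]
      · simp [add_assoc])
    (fun x => by ext i <;> simp)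
    (fun x => by ext i <;> simp [CharTwo.add_self_eq_zero])

/-- The letters of the presentation in the wreath product. -/
def ofLetter : LampLetter → LampState
  | LampLetter.a => ⟨Pi.single 0 1, 0⟩
  | LampLetter.t => ⟨0, 1⟩

theorem step_zpow (n : ℤ) : ofLetter LampLetter.t ^ n = ⟨0, n⟩ := by
  induction n with
  | zero => rfl
  | succ n ih => rw [zpow_add_one, ih]; ext i <;> simp [ofLetter]
  | pred n ih => rw [zpow_sub_one, ih]; ext i <;> simp [ofLetter, sub_eq_add_neg]

theorem lift_eq_one : ∀ r ∈ lampRelators, FreeGroup.lift ofLetter r = 1 := by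
  rintro r (hr | ⟨i, j, rfl⟩)
  · rw [Set.mem_singleton_iff.mp hr, map_pow, FreeGroup.lift_apply_of, sq]
    ext i
    · simp [ofLetter, CharTwo.add_self_eq_zero]
    · simp [ofLetter]
  · rw [map_commutatorElement, commutatorElement_eq_one_iff_mul_comm]
    simp only [map_mul, map_inv, map_zpow, FreeGroup.lift_apply_of, step_zpow]
    ext k
    · simp [ofLetter, add_comm]
    · simp [ofLetter]

end LampState

/-! ### Normal form and faithfulness of the lamp states -/

namespace Lamplighter

/-- The lamps and the position of an element of the lamplighter group. -/
noncomputable def state : Lamplighter →* LampState :=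
  PresentedGroup.toGroup (f := LampState.ofLetter) LampState.lift_eq_one

theorem state_lampA : state lampA = ⟨Pi.single 0 1, 0⟩ :=
  PresentedGroup.toGroup.of LampState.lift_eq_one

theorem state_lampT : state lampT = ⟨0, 1⟩ :=
  PresentedGroup.toGroup.of LampState.lift_eq_one

theorem state_lampT_zpow (n : ℤ) : state (lampT ^ n) = ⟨0, n⟩ := by
  rw [map_zpow, state_lampT]
  exact LampState.step_zpow n

theorem lampA_mul_self : lampA * lampA = 1 := by
  rw [← sq]
  exact PresentedGroup.one_of_mem (rels := lampRelators) (Or.inl rfl)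

/-- The element which toggles the lamp at `i`. -/
noncomputable def toggle (i : ℤ) : Lamplighter := lampT ^ i * lampA * (lampT ^ i)⁻¹

theorem toggle_mul_self (i : ℤ) : toggle i * toggle i = 1 := by
  calc toggle i * toggle i = lampT ^ i * (lampA * lampA) * (lampT ^ i)⁻¹ := by rw [toggle]; group
    _ = 1 := by rw [lampA_mul_self, mul_one, mul_inv_cancel]

theorem toggle_comm (i j : ℤ) : toggle i * toggle j = toggle j * toggle i := by
  -- The signs change because the relators conjugate as t⁻ⁱatⁱ and `toggle i` is tⁱat⁻ⁱ.
  have h := PresentedGroup.one_of_mem (rels := lampRelators) (Or.inr ⟨-i, -j, rfl⟩)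
  have h' : ⁅toggle i, toggle j⁆ = 1 := by
    simp only [zpow_neg, inv_inv] at h
    exact h
  exact commutatorElement_eq_one_iff_mul_comm.mp h'

theorem state_toggle (i : ℤ) : state (toggle i) = ⟨Pi.single i 1, 0⟩ := by
  rw [toggle, map_mul, map_mul, map_inv, state_lampT_zpow, state_lampA]
  ext k
  · simp [Pi.single_apply, sub_eq_zero]
  · simp

/-- Toggle all the lamps of a finite set. -/
noncomputable def toggles (s : Finset ℤ) : Lamplighter :=
  s.noncommProd toggle fun i _ j _ _ => toggle_comm i j

theorem toggles_insert {s : Finset ℤ} {i : ℤ} (h : i ∉ s) :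
    toggles (insert i s) = toggles s * toggle i :=
  Finset.noncommProd_insert_of_notMem' _ _ _ _ h

theorem exists_toggles_mul (s : Finset ℤ) (i : ℤ) : ∃ s', toggles s' = toggles s * toggle i := by
  by_cases h : i ∈ s
  · refine ⟨s.erase i, ?_⟩
    nth_rewrite 2 [← Finset.insert_erase h]
    rw [toggles_insert (Finset.notMem_erase i s), mul_assoc, toggle_mul_self, mul_one]
  · exact ⟨insert i s, toggles_insert h⟩

theorem state_toggles (s : Finset ℤ) :
    state (toggles s) = ⟨fun i => if i ∈ s then 1 else 0, 0⟩ := by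
  induction s using Finset.induction_on with
  | empty => simp [toggles]; rfl
  | insert i s h ih =>
    rw [toggles_insert h, map_mul, ih, state_toggle]
    ext k
    · by_cases hk : k = i
      · subst hk; simp [h]
      · simp [hk]
    · simp

/-- The normal form in the lamplighter group. -/
theorem exists_normalForm (x : Lamplighter) : ∃ (s : Finset ℤ) (n : ℤ),
    x = toggles s * lampT ^ n := by
  have ha : ∀ (s : Finset ℤ) (n : ℤ), ∃ s' : Finset ℤ,
      toggles s * lampT ^ n * lampA = toggles s' * lampT ^ n := by
    intro s n
    obtain ⟨s', hs'⟩ := exists_toggles_mul s n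
    refine ⟨s', ?_⟩
    rw [hs', toggle]
    group
  have hx : x ∈ Subgroup.closure lampGenerators := closure_lampGenerators ▸ Subgroup.mem_top x
  induction hx using Subgroup.closure_induction_right with
  | one => exact ⟨∅, 0, by rw [zpow_zero, mul_one]; rfl⟩
  | mul_right x _ y hy ih =>
    obtain ⟨s, n, rfl⟩ := ih
    rcases hy with rfl | rfl
    · exact ⟨s, n + 1, by rw [zpow_add_one, mul_assoc]⟩
    · obtain ⟨s', hs'⟩ := ha s n
      exact ⟨s', n + 1, by rw [← mul_assoc, hs', zpow_add_one, mul_assoc]⟩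
  | mul_inv_cancel x _ y hy ih =>
    obtain ⟨s, n, rfl⟩ := ih
    rcases hy with rfl | rfl
    · exact ⟨s, n - 1, by rw [zpow_sub_one, mul_assoc]⟩
    · obtain ⟨s', hs'⟩ := ha s (n - 1)
      refine ⟨s', n - 1, ?_⟩
      rw [← hs', zpow_sub_one, mul_inv_rev, inv_eq_of_mul_eq_one_left lampA_mul_self]
      group

theorem state_injective : Function.Injective state := by
  intro x y h
  obtain ⟨s, n, rfl⟩ := exists_normalForm x
  obtain ⟨s', n', rfl⟩ := exists_normalForm y
  rw [map_mul, map_mul, state_toggles, state_toggles, state_lampT_zpow, state_lampT_zpow] at h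
  have h1 : n = n' := by simpa using congrArg LampState.pos h
  have h2 : s = s' := by
    ext i
    have := congrFun (congrArg LampState.lamps h) i
    by_cases hs : i ∈ s <;> by_cases hs' : i ∈ s' <;> simp [hs, hs'] at this ⊢
  rw [h1, h2]

/-! ### Confluents of lamp configurations -/

/-- The lamps of an element which are lit form a finite set. -/
theorem exists_finset_lamps (x : Lamplighter) : ∃ s : Finset ℤ, ∀ i ∉ s, (state x).lamps i = 0 := by
  obtain ⟨s, n, rfl⟩ := exists_normalForm x
  refine ⟨s, fun i hi => ?_⟩
  rw [map_mul, state_toggles, state_lampT_zpow]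
  simp [hi]

/-- The conditions pass to smaller k, fail above the positions, and hold below all lit lamps. Lamp i
sits on the edge from height i to i + 1, whence i < k here and i ≥ k in `exists_upper`. -/
theorem exists_lower (x y : Lamplighter) : ∃ m : ℤ, ∀ k : ℤ, k ≤ m ↔
    k ≤ (state x).pos ∧ k ≤ (state y).pos ∧ ∀ i < k, (state x).lamps i = (state y).lamps i := by
  obtain ⟨s, hs⟩ := exists_finset_lamps x
  obtain ⟨s', hs'⟩ := exists_finset_lamps y
  obtain ⟨l, hl⟩ := (s ∪ s').bddBelow
  obtain ⟨m, hm, hm'⟩ := Int.exists_greatest_of_bdd (P := fun k => k ≤ (state x).pos ∧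
    k ≤ (state y).pos ∧ ∀ i < k, (state x).lamps i = (state y).lamps i)
    ⟨(state x).pos, fun k hk => hk.1⟩
    ⟨min l (min (state x).pos (state y).pos), by omega, by omega, fun i hi => by
      have : i ∉ s ∪ s' := fun h => by have := hl h; omega
      rw [Finset.mem_union, not_or] at this
      rw [hs i this.1, hs' i this.2]⟩
  exact ⟨m, fun k => ⟨fun hk => ⟨hk.trans hm.1, hk.trans hm.2.1,
    fun i hi => hm.2.2 i (hi.trans_le hk)⟩, hm' k⟩⟩

theorem exists_upper (x y : Lamplighter) : ∃ m : ℤ, ∀ k : ℤ, m ≤ k ↔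
    (state x).pos ≤ k ∧ (state y).pos ≤ k ∧ ∀ i ≥ k, (state x).lamps i = (state y).lamps i := by
  obtain ⟨s, hs⟩ := exists_finset_lamps x
  obtain ⟨s', hs'⟩ := exists_finset_lamps y
  obtain ⟨l, hl⟩ := (s ∪ s').bddAbove
  obtain ⟨m, hm, hm'⟩ := Int.exists_least_of_bdd (P := fun k => (state x).pos ≤ k ∧
    (state y).pos ≤ k ∧ ∀ i ≥ k, (state x).lamps i = (state y).lamps i)
    ⟨(state x).pos, fun k hk => hk.1⟩
    ⟨max (l + 1) (max (state x).pos (state y).pos), by omega, by omega, fun i hi => by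
      have : i ∉ s ∪ s' := fun h => by have := hl h; omega
      rw [Finset.mem_union, not_or] at this
      rw [hs i this.1, hs' i this.2]⟩
  exact ⟨m, fun k => ⟨fun hk => ⟨hm.1.trans hk, hm.2.1.trans hk,
    fun i hi => hm.2.2 i (hk.trans hi)⟩, hm' k⟩⟩

/-- The largest height below which two elements and their lamps agree. -/
noncomputable def lower (x y : Lamplighter) : ℤ := (exists_lower x y).choose

/-- The least height above which two elements and their lamps agree. -/
noncomputable def upper (x y : Lamplighter) : ℤ := (exists_upper x y).choose

theorem le_lower_iff {x y : Lamplighter} {k : ℤ} : k ≤ lower x y ↔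
    k ≤ (state x).pos ∧ k ≤ (state y).pos ∧ ∀ i < k, (state x).lamps i = (state y).lamps i :=
  (exists_lower x y).choose_spec k

theorem upper_le_iff {x y : Lamplighter} {k : ℤ} : upper x y ≤ k ↔
    (state x).pos ≤ k ∧ (state y).pos ≤ k ∧ ∀ i ≥ k, (state x).lamps i = (state y).lamps i :=
  (exists_upper x y).choose_spec k

theorem lower_comm (x y : Lamplighter) : lower x y = lower y x :=
  eq_of_forall_le_iff fun k => by
    rw [le_lower_iff, le_lower_iff, and_left_comm]
    simp only [eq_comm]

theorem upper_comm (x y : Lamplighter) : upper x y = upper y x :=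
  eq_of_forall_ge_iff fun k => by
    rw [upper_le_iff, upper_le_iff, and_left_comm]
    simp only [eq_comm]

theorem lower_le (x y : Lamplighter) : lower x y ≤ (state x).pos := (le_lower_iff.mp le_rfl).1

theorem le_upper (x y : Lamplighter) : (state x).pos ≤ upper x y := (upper_le_iff.mp le_rfl).1

theorem lower_ultra (x y z : Lamplighter) : min (lower x y) (lower y z) ≤ lower x z := by
  have h1 := le_lower_iff.mp (min_le_left (lower x y) (lower y z))
  have h2 := le_lower_iff.mp (min_le_right (lower x y) (lower y z))
  exact le_lower_iff.mpr ⟨h1.1, h2.2.1, fun i hi => (h1.2.2 i hi).trans (h2.2.2 i hi)⟩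

theorem upper_ultra (x y z : Lamplighter) : upper x z ≤ max (upper x y) (upper y z) := by
  have h1 := upper_le_iff.mp (le_max_left (upper x y) (upper y z))
  have h2 := upper_le_iff.mp (le_max_right (upper x y) (upper y z))
  exact upper_le_iff.mpr ⟨h1.1, h2.2.1, fun i hi => (h1.2.2 i hi).trans (h2.2.2 i hi)⟩

/-! ### The word metric as the distance of the horocyclic product -/

/-- The distance of the horocyclic product. -/
noncomputable def treeDist (x y : Lamplighter) : ℤ :=
  2 * (upper x y - lower x y) -
    max ((state x).pos - (state y).pos) ((state y).pos - (state x).pos)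

theorem treeDist_triangle (x y z : Lamplighter) : treeDist x z ≤ treeDist x y + treeDist y z := by
  have a1 := lower_le x y
  have a2 := lower_comm x y ▸ lower_le y x
  have a3 := lower_le y z
  have a4 := lower_comm y z ▸ lower_le z y
  have b1 := le_upper x y
  have b2 := upper_comm x y ▸ le_upper y x
  have b3 := le_upper y z
  have b4 := upper_comm y z ▸ le_upper z y
  have u1 := lower_ultra x y z
  have u2 := upper_ultra x y z
  rw [treeDist, treeDist, treeDist]
  omega

theorem treeDist_comm (x y : Lamplighter) : treeDist x y = treeDist y x := by
  rw [treeDist, treeDist, upper_comm, lower_comm, max_comm]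

theorem treeDist_self (x : Lamplighter) : treeDist x x = 0 := by
  have h1 : lower x x = (state x).pos :=
    le_antisymm (lower_le x x) (le_lower_iff.mpr ⟨le_rfl, le_rfl, fun _ _ => rfl⟩)
  have h2 : upper x x = (state x).pos :=
    le_antisymm (upper_le_iff.mpr ⟨le_rfl, le_rfl, fun _ _ => rfl⟩) (le_upper x x)
  rw [treeDist, h1, h2]
  omega

theorem eq_of_treeDist_eq_zero {x y : Lamplighter} (h : treeDist x y = 0) : x = y := by
  obtain ⟨a1, a2, a3⟩ := le_lower_iff.mp (le_refl (lower x y))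
  obtain ⟨b1, b2, b3⟩ := upper_le_iff.mp (le_refl (upper x y))
  rw [treeDist] at h
  refine state_injective (LampState.ext (funext fun i => ?_) (by omega))
  rcases lt_or_ge i (lower x y) with hi | hi
  · exact a3 i hi
  · exact b3 i (by omega)

theorem treeDist_mul_generator (x : Lamplighter) {s : Lamplighter} (hs : s ∈ lampGenerators) :
    treeDist x (x * s) ≤ 1 := by
  have key : (state (x * s)).pos = (state x).pos + 1 ∧
      ∀ i ≠ (state x).pos, (state x).lamps i = (state (x * s)).lamps i := by
    rcases hs with rfl | rfl
    · simp [state_lampT]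
    · simp only [map_mul, state_lampT, state_lampA]
      refine ⟨by simp, fun i hi => ?_⟩
      simp [sub_ne_zero.mpr hi]
  obtain ⟨h1, h2⟩ := key
  have l : (state x).pos ≤ lower x (x * s) :=
    le_lower_iff.mpr ⟨le_rfl, by omega, fun i hi => h2 i hi.ne⟩
  have u : upper x (x * s) ≤ (state x).pos + 1 :=
    upper_le_iff.mpr ⟨by omega, by omega, fun i hi => h2 i (by omega)⟩
  rw [treeDist]
  omega

theorem treeDist_le_length (l : List Lamplighter) (hl : ∀ s ∈ l, s ∈ lampGenerators ∨
    s⁻¹ ∈ lampGenerators) (x : Lamplighter) : treeDist x (x * l.prod) ≤ l.length := by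
  induction l generalizing x with
  | nil => simp [treeDist_self]
  | cons s l ih =>
    have h1 := ih (fun s hs => hl s (List.mem_cons_of_mem _ hs)) (x * s)
    have h2 : treeDist x (x * s) ≤ 1 := by
      rcases hl s List.mem_cons_self with h | h
      · exact treeDist_mul_generator x h
      · have := treeDist_mul_generator (x * s) h
        rwa [mul_inv_cancel_right, treeDist_comm] at this
    have h3 := treeDist_triangle x (x * s) (x * s * l.prod)
    rw [List.prod_cons, List.length_cons, ← mul_assoc]
    push_cast
    omega

/-- A step up which leaves the lamp it passes in a prescribed state. -/
theorem exists_step_up (x : Lamplighter) (v : ZMod 2) : ∃ s ∈ lampGenerators,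
    (state (x * s)).pos = (state x).pos + 1 ∧ (state (x * s)).lamps (state x).pos = v ∧
      ∀ i ≠ (state x).pos, (state (x * s)).lamps i = (state x).lamps i := by
  by_cases h : (state x).lamps (state x).pos = v
  · exact ⟨lampT, Or.inl rfl, by simp [state_lampT], by simp [state_lampT, h],
      fun i _ => by simp [state_lampT]⟩
  · refine ⟨lampA * lampT, Or.inr rfl, by simp [state_lampT, state_lampA], ?_, fun i hi => ?_⟩
    · simp only [map_mul, state_lampA, state_lampT, LampState.mul_lamps, sub_self,
        Pi.single_eq_same, Pi.zero_apply, add_zero]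
      generalize (state x).lamps (state x).pos = w at h
      revert v w
      decide
    · simp [state_lampT, state_lampA, sub_ne_zero.mpr hi]

/-- A step down which leaves the lamp it passes in a prescribed state. -/
theorem exists_step_down (x : Lamplighter) (v : ZMod 2) : ∃ s, s⁻¹ ∈ lampGenerators ∧
    (state (x * s)).pos = (state x).pos - 1 ∧ (state (x * s)).lamps ((state x).pos - 1) = v ∧
      ∀ i ≠ (state x).pos - 1, (state (x * s)).lamps i = (state x).lamps i := by
  have hT : state lampT⁻¹ = ⟨0, -1⟩ := by
    rw [map_inv, state_lampT]
    ext i <;> simp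
  have hA : state (lampA * lampT)⁻¹ = ⟨Pi.single (-1) 1, -1⟩ := by
    rw [map_inv, map_mul, state_lampA, state_lampT]
    ext i
    · simp [Pi.single_apply, eq_neg_iff_add_eq_zero, ZMod.neg_eq_self_mod_two]
    · simp
  by_cases h : (state x).lamps ((state x).pos - 1) = v
  · refine ⟨lampT⁻¹, ?_, ?_, ?_, ?_⟩
    · rw [inv_inv]; exact Or.inl rfl
    · rw [map_mul, hT]; rfl
    · rw [map_mul, hT]; simp [h]
    · rw [map_mul, hT]; simp
  · refine ⟨(lampA * lampT)⁻¹, ?_, ?_, ?_, fun i hi => ?_⟩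
    · rw [inv_inv]; exact Or.inr rfl
    · rw [map_mul, hA]; rfl
    · rw [map_mul, hA, LampState.mul_lamps, sub_sub_cancel_left]
      simp only [Pi.single_eq_same]
      generalize (state x).lamps ((state x).pos - 1) = w at h
      revert v w
      decide
    · have hi' : i - (state x).pos ≠ -1 := by omega
      rw [map_mul, hA, LampState.mul_lamps]
      simp only [Pi.single_eq_of_ne hi', add_zero]

/-- One can always move closer. -/
theorem exists_closer {x y : Lamplighter} (h : treeDist x y ≠ 0) : ∃ s,
    (s ∈ lampGenerators ∨ s⁻¹ ∈ lampGenerators) ∧ treeDist (x * s) y ≤ treeDist x y - 1 := by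
  obtain ⟨a1, a2, a3⟩ := le_lower_iff.mp (le_refl (lower x y))
  obtain ⟨b1, b2, b3⟩ := upper_le_iff.mp (le_refl (upper x y))
  -- A geodesic from x to a y at the same height or above descends to `lower`, climbs to `upper`,
  -- then returns to y; for y below x it climbs first. The step up is right in exactly these cases.
  -- Setting the passed lamp as in y never destroys an agreement.
  have up : ((state y).pos < (state x).pos ∧ (state x).pos < upper x y ∨
      (state x).pos ≤ (state y).pos ∧ lower x y = (state x).pos) → ∃ s,
      (s ∈ lampGenerators ∨ s⁻¹ ∈ lampGenerators) ∧ treeDist (x * s) y ≤ treeDist x y - 1 := by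
    intro hup
    obtain ⟨s, hs, h1, h2, h3⟩ := exists_step_up x ((state y).lamps (state x).pos)
    refine ⟨s, Or.inl hs, ?_⟩
    have hlamps : ∀ i, (state x).lamps i = (state y).lamps i →
        (state (x * s)).lamps i = (state y).lamps i := by
      intro i hi
      by_cases hix : i = (state x).pos
      · rw [hix, h2]
      · rw [h3 i hix, hi]
    have u : upper (x * s) y ≤ upper x y :=
      upper_le_iff.mpr ⟨by rw [treeDist] at h; omega, b2, fun i hi => hlamps i (b3 i hi)⟩
    have l : lower x y ≤ lower (x * s) y :=
      le_lower_iff.mpr ⟨by omega, a2, fun i hi => hlamps i (a3 i hi)⟩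
    have l' : lower x y = (state x).pos → (state x).pos + 1 ≤ (state y).pos →
        lower x y + 1 ≤ lower (x * s) y := fun e e' =>
      le_lower_iff.mpr ⟨by omega, by omega, fun i hi => by
        by_cases hix : i = (state x).pos
        · rw [hix, h2]
        · exact hlamps i (a3 i (by omega))⟩
    rw [treeDist] at h ⊢
    rw [treeDist, h1]
    omega
  have down : ((state x).pos ≤ (state y).pos ∧ lower x y < (state x).pos ∨
      (state y).pos < (state x).pos ∧ upper x y = (state x).pos) → ∃ s,
      (s ∈ lampGenerators ∨ s⁻¹ ∈ lampGenerators) ∧ treeDist (x * s) y ≤ treeDist x y - 1 := by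
    intro hdown
    obtain ⟨s, hs, h1, h2, h3⟩ := exists_step_down x ((state y).lamps ((state x).pos - 1))
    refine ⟨s, Or.inr hs, ?_⟩
    have hlamps : ∀ i, (state x).lamps i = (state y).lamps i →
        (state (x * s)).lamps i = (state y).lamps i := by
      intro i hi
      by_cases hix : i = (state x).pos - 1
      · rw [hix, h2]
      · rw [h3 i hix, hi]
    have l : lower x y ≤ lower (x * s) y :=
      le_lower_iff.mpr ⟨by omega, a2, fun i hi => hlamps i (a3 i hi)⟩
    have u : upper (x * s) y ≤ upper x y :=
      upper_le_iff.mpr ⟨by omega, b2, fun i hi => hlamps i (b3 i hi)⟩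
    have u' : upper x y = (state x).pos → (state y).pos ≤ (state x).pos - 1 →
        upper (x * s) y ≤ upper x y - 1 := fun e e' =>
      upper_le_iff.mpr ⟨by omega, by omega, fun i hi => by
        by_cases hix : i = (state x).pos - 1
        · rw [hix, h2]
        · exact hlamps i (b3 i (by omega))⟩
    rw [treeDist] at h ⊢
    rw [treeDist, h1]
    omega
  by_cases hup : ((state y).pos < (state x).pos ∧ (state x).pos < upper x y ∨
      (state x).pos ≤ (state y).pos ∧ lower x y = (state x).pos)
  · exact up hup
  · exact down (by omega)

theorem exists_word_of_treeDist_le (n : ℕ) (x y : Lamplighter) (h : treeDist x y ≤ n) :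
    ∃ l : List Lamplighter, IsWordFor lampGenerators (x⁻¹ * y) l ∧ l.length ≤ n := by
  induction n generalizing x with
  | zero =>
    have h1 := treeDist_triangle x y x
    rw [treeDist_self, treeDist_comm y x] at h1
    have : x = y := eq_of_treeDist_eq_zero (by push_cast at h; omega)
    exact ⟨[], ⟨by simp, by simp [this]⟩, le_rfl⟩
  | succ n ih =>
    by_cases h0 : treeDist x y = 0
    · rw [eq_of_treeDist_eq_zero h0]
      exact ⟨[], ⟨by simp, by simp⟩, Nat.zero_le _⟩
    · obtain ⟨s, hs, hs'⟩ := exists_closer h0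
      obtain ⟨l, ⟨hl, hp⟩, hn⟩ := ih (x * s) (by push_cast at h; omega)
      refine ⟨s :: l, ⟨?_, ?_⟩, by simpa using hn⟩
      · rintro u hu
        rcases List.mem_cons.mp hu with rfl | hu
        · exact hs
        · exact hl u hu
      · rw [List.prod_cons, hp]
        group

theorem dist_eq_wordLength (x y : Lamplighter) :
    dist x y = (wordLength lampGenerators (x⁻¹ * y) : ℝ) := rfl

theorem dist_eq_treeDist (x y : Lamplighter) : dist x y = (treeDist x y : ℝ) := by
  have h : (wordLength lampGenerators (x⁻¹ * y) : ℤ) = treeDist x y := by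
    apply le_antisymm
    · have h1 := treeDist_triangle x y x
      rw [treeDist_self, treeDist_comm y x] at h1
      obtain ⟨l, hl, hn⟩ := exists_word_of_treeDist_le (treeDist x y).toNat x y (by omega)
      have := wordLength_le hl
      omega
    · obtain ⟨l, ⟨hl, hp⟩, hn⟩ := exists_word closure_lampGenerators (x⁻¹ * y)
      have := treeDist_le_length l hl x
      rw [hp, mul_inv_cancel_left, hn] at this
      exact this
  rw [dist_eq_wordLength, ← h, Int.cast_natCast]

/-- The lamplighter group is a horocyclic product of two trees. -/
noncomputable def horocyclicProduct : HorocyclicProduct Lamplighter where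
  height x := (state x).pos
  lower := lower
  upper := upper
  lower_comm := lower_comm
  upper_comm := upper_comm
  lower_le := lower_le
  le_upper := le_upper
  lower_ultra := lower_ultra
  upper_ultra := upper_ultra
  dist_eq := dist_eq_treeDist

end Lamplighter

/-! ## The visual boundary is not Hausdorff -/

/-- A shortcut between two points of the path would persist for all later times, so the lower bound
far out suffices. -/
theorem isometry_of_dist_succ_le {X : Type*} [MetricSpace X] {γ : ℕ → X}
    (h1 : ∀ n, dist (γ n) (γ (n + 1)) ≤ 1) {N : ℕ} (h2 : ∀ n ≥ N, (n : ℝ) ≤ dist (γ 0) (γ n)) :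
    Isometry γ := by
  have lip : ∀ i d : ℕ, dist (γ i) (γ (i + d)) ≤ d := by
    intro i d
    induction d with
    | zero => simp
    | succ d ih =>
      have := dist_triangle (γ i) (γ (i + d)) (γ (i + d + 1))
      have := h1 (i + d)
      rw [← add_assoc]
      push_cast
      linarith
  have key : ∀ i d : ℕ, dist (γ i) (γ (i + d)) = d := by
    intro i d
    refine le_antisymm (lip i d) ?_
    have a1 := dist_triangle4 (γ 0) (γ i) (γ (i + d)) (γ (i + d + N))
    have a2 := lip 0 i
    have a3 := lip (i + d) N
    have a4 := h2 (i + d + N) (Nat.le_add_left _ _)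
    rw [zero_add] at a2
    push_cast at a4
    linarith
  refine Isometry.of_dist_eq fun i j => ?_
  rcases le_total i j with h | h <;> obtain ⟨d, rfl⟩ := Nat.exists_eq_add_of_le h
  · rw [key, Nat.dist_eq]
    simp
  · rw [dist_comm, key, Nat.dist_eq]
    simp

theorem isometry_of_eventually_eq {X : Type*} [MetricSpace X] {F : ℕ → ℕ → X} {γ : ℕ → X}
    (hF : ∀ᶠ m in atTop, Isometry (F m)) (h : ∀ n, ∀ᶠ m in atTop, F m n = γ n) : Isometry γ := by
  refine Isometry.of_dist_eq fun i j => ?_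
  obtain ⟨m, h1, h2, h3⟩ := (hF.and ((h i).and (h j))).exists
  rw [← h2, ← h3, h1.dist_eq]

theorem tendsto_toBoundary {X : Type*} [MetricSpace X] {b : X} {F : ℕ → GeodesicRay X b}
    {γ : GeodesicRay X b} (h : ∀ n, ∀ᶠ m in atTop, (F m).1 n = γ.1 n) :
    Tendsto (fun m => (F m).toBoundary) atTop (𝓝 γ.toBoundary) := by
  have hc : Continuous (GeodesicRay.toBoundary : GeodesicRay X b → VisualBoundary X b) :=
    continuous_quotient_mk'
  refine (hc.tendsto γ).comp ?_
  rw [tendsto_subtype_rng, ContinuousMap.isHomeomorph_coe.isInducing.tendsto_nhds_iff,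
    tendsto_pi_nhds]
  exact fun n => tendsto_nhds_of_eventually_eq (h n)

/-! ### Two families of asymptotic rays with different limits -/

namespace Lamplighter

theorem dist_mul_left (g x y : Lamplighter) : dist (g * x) (g * y) = dist x y := by
  rw [dist_eq_wordLength, dist_eq_wordLength]
  congr 2
  group

theorem dist_mul_le_one (x : Lamplighter) {s : Lamplighter}
    (hs : s ∈ lampGenerators ∨ s⁻¹ ∈ lampGenerators) : dist x (x * s) ≤ 1 := by
  rw [dist_eq_treeDist]
  rcases hs with h | h
  · exact_mod_cast treeDist_mul_generator x h
  · have := treeDist_mul_generator (x * s) h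
    rw [mul_inv_cancel_right, treeDist_comm] at this
    exact_mod_cast this

theorem dist_mul_lampT (x : Lamplighter) : dist x (x * lampT) ≤ 1 :=
  dist_mul_le_one x (Or.inl (Or.inl rfl))

theorem dist_mul_lampT_inv (x : Lamplighter) : dist x (x * lampT⁻¹) ≤ 1 :=
  dist_mul_le_one x (Or.inr (Or.inl (inv_inv _)))

theorem dist_mul_lampT_inv_mul_lampA (x : Lamplighter) : dist x (x * (lampT⁻¹ * lampA)) ≤ 1 := by
  refine dist_mul_le_one x (Or.inr (Or.inr ?_))
  rw [mul_inv_rev, inv_inv, inv_eq_of_mul_eq_one_left lampA_mul_self]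
  rfl

/-- The path which descends to height `-m`, lights the lamp there, and ascends. -/
noncomputable def valley (m n : ℕ) : Lamplighter :=
  if n < m then lampT ^ (-n : ℤ) else lampT ^ (-m : ℤ) * lampA * lampT ^ (n - m : ℤ)

/-- The variant of `valley` which lights the lamp at `-1` on its way down, and extinguishes it on
its way up. -/
noncomputable def litValley (m n : ℕ) : Lamplighter :=
  if 1 ≤ n ∧ n < 2 * m then toggle (-1) * valley m n else valley m n

theorem valley_zero {m : ℕ} (hm : 2 ≤ m) : valley m 0 = 1 := by
  rw [valley, if_pos (by omega)]
  simp

theorem litValley_zero {m : ℕ} (hm : 2 ≤ m) : litValley m 0 = 1 := by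
  rw [litValley, if_neg (by omega), valley_zero hm]

theorem dist_valley_succ (m n : ℕ) : dist (valley m n) (valley m (n + 1)) ≤ 1 := by
  rcases lt_trichotomy (n + 1) m with h | h | h
  · rw [valley, valley, if_pos (by omega), if_pos h]
    have : lampT ^ (-(n + 1 : ℕ) : ℤ) = lampT ^ (-n : ℤ) * lampT⁻¹ := by
      rw [← zpow_sub_one]
      congr 1
      push_cast
      ring
    rw [this]
    exact dist_mul_lampT_inv _
  · rw [valley, valley, if_pos (by omega), if_neg (by omega)]
    have : lampT ^ (-m : ℤ) * lampA * lampT ^ ((n + 1 : ℕ) - m : ℤ)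
        = lampT ^ (-n : ℤ) * (lampT⁻¹ * lampA) := by
      rw [h, sub_self, zpow_zero, mul_one, ← mul_assoc, ← zpow_sub_one, ← h]
      congr 2
      push_cast
      ring
    rw [this]
    exact dist_mul_lampT_inv_mul_lampA _
  · rw [valley, valley, if_neg (by omega), if_neg (by omega)]
    have : lampT ^ ((n + 1 : ℕ) - m : ℤ) = lampT ^ (n - m : ℤ) * lampT := by
      rw [← zpow_add_one]
      congr 1
      push_cast
      ring
    rw [this, ← mul_assoc]
    exact dist_mul_lampT _

theorem dist_litValley_succ {m : ℕ} (hm : 2 ≤ m) (n : ℕ) :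
    dist (litValley m n) (litValley m (n + 1)) ≤ 1 := by
  rcases Nat.eq_zero_or_pos n with rfl | hn
  · rw [litValley_zero hm, litValley, if_pos (by omega), valley, if_pos (by omega)]
    have : toggle (-1) * lampT ^ (-(0 + 1 : ℕ) : ℤ) = 1 * (lampT⁻¹ * lampA) := by
      rw [toggle]
      simp
    rw [this]
    exact dist_mul_lampT_inv_mul_lampA _
  rcases lt_trichotomy (n + 1) (2 * m) with h | h | h
  -- Between the two special steps both points carry the same left factor `toggle (-1)`, and the
  -- metric is left-invariant.
  · rw [litValley, litValley, if_pos (by omega), if_pos (by omega), dist_mul_left]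
    exact dist_valley_succ m n
  -- The step from height -1 to 0 passes the lamp at -1 and extinguishes it; here the path rejoins
  -- `valley`.
  · rw [litValley, litValley, if_pos (by omega), if_neg (by omega), valley, valley,
      if_neg (by omega), if_neg (by omega)]
    have h1 : lampT ^ (-m : ℤ) * lampA * lampT ^ ((n + 1 : ℕ) - m : ℤ) = toggle (-m) := by
      rw [toggle, ← zpow_neg]
      congr 2
      omega
    have h2 : lampT ^ (-m : ℤ) * lampA * lampT ^ (n - m : ℤ) = toggle (-m) * lampT⁻¹ := by
      rw [← h1, mul_assoc _ _ lampT⁻¹, ← zpow_sub_one]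
      congr 2
      push_cast
      ring
    have h3 : toggle (-1) * (toggle (-m) * lampT⁻¹) = toggle (-m) * (lampT⁻¹ * lampA) := by
      rw [← mul_assoc, toggle_comm, mul_assoc]
      congr 1
      rw [toggle]
      group
    rw [h1, h2, h3, dist_comm]
    exact dist_mul_lampT_inv_mul_lampA _
  · rw [litValley, litValley, if_neg (by omega), if_neg (by omega)]
    exact dist_valley_succ m n

/-- The lit lamp forces `lower` down to -m and the position forces `upper` up to n - 2m, so the
distance is at least 2(n - m) - (n - 2m) = n. -/
theorem le_dist_valley {m n : ℕ} (h : 2 * m ≤ n) : (n : ℝ) ≤ dist 1 (valley m n) := by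
  have hs : state (valley m n) = ⟨Pi.single (-m) 1, n - 2 * m⟩ := by
    rw [valley]
    split_ifs with hnm
    · obtain ⟨rfl, rfl⟩ : n = 0 ∧ m = 0 := by omega
      omega
    · rw [map_mul, map_mul, state_lampT_zpow, state_lampT_zpow, state_lampA]
      ext i
      · simp [Pi.single_apply, ← sub_eq_zero (b := -(m : ℤ))]
      · simp
        ring
  have l : lower 1 (valley m n) ≤ -m := by
    by_contra hl
    have := (le_lower_iff.mp (show -(m : ℤ) + 1 ≤ lower 1 (valley m n) by omega)).2.2 (-m)
      (by omega)
    rw [hs] at this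
    simp at this
  have u := upper_comm 1 (valley m n) ▸ le_upper (valley m n) 1
  rw [hs] at u
  change (n : ℤ) - 2 * m ≤ _ at u
  have : (n : ℤ) ≤ treeDist 1 (valley m n) := by
    rw [treeDist, hs, map_one, LampState.one_pos]
    dsimp only
    omega
  rw [dist_eq_treeDist]
  exact_mod_cast this

theorem isometry_valley {m : ℕ} (hm : 2 ≤ m) : Isometry (valley m) :=
  isometry_of_dist_succ_le (dist_valley_succ m) (N := 2 * m) fun n hn => by
    rw [valley_zero hm]
    exact le_dist_valley hn

theorem isometry_litValley {m : ℕ} (hm : 2 ≤ m) : Isometry (litValley m) :=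
  isometry_of_dist_succ_le (dist_litValley_succ hm) (N := 2 * m) fun n hn => by
    rw [litValley_zero hm, litValley, if_neg (by omega)]
    exact le_dist_valley hn

theorem eventually_valley_eq (n : ℕ) : ∀ᶠ m in atTop, valley (m + 2) n = lampT ^ (-n : ℤ) := by
  filter_upwards [eventually_ge_atTop n] with m hm
  rw [valley, if_pos (by omega)]

theorem eventually_litValley_eq (n : ℕ) : ∀ᶠ m in atTop, litValley (m + 2) n =
    if 1 ≤ n then toggle (-1) * lampT ^ (-n : ℤ) else lampT ^ (-n : ℤ) := by
  filter_upwards [eventually_ge_atTop n] with m hm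
  rw [litValley, valley, if_pos (show n < m + 2 by omega)]
  simp only [show n < 2 * (m + 2) by omega, and_true]

/-- The ray along `valley`. -/
noncomputable def valleyRay (m : ℕ) : GeodesicRay Lamplighter 1 :=
  ⟨⟨valley (m + 2), continuous_of_discreteTopology⟩, isometry_valley (Nat.le_add_left 2 m),
    valley_zero (Nat.le_add_left 2 m)⟩

/-- The ray along `litValley`. -/
noncomputable def litValleyRay (m : ℕ) : GeodesicRay Lamplighter 1 :=
  ⟨⟨litValley (m + 2), continuous_of_discreteTopology⟩, isometry_litValley (Nat.le_add_left 2 m),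
    litValley_zero (Nat.le_add_left 2 m)⟩

/-- The ray which descends with all lamps off. -/
noncomputable def descent : GeodesicRay Lamplighter 1 :=
  ⟨⟨fun n => lampT ^ (-n : ℤ), continuous_of_discreteTopology⟩,
    isometry_of_eventually_eq (F := fun m => valley (m + 2))
      (Eventually.of_forall fun m => isometry_valley (by omega)) eventually_valley_eq, by simp⟩

/-- The ray which descends and lights the lamp at `-1`. -/
noncomputable def litDescent : GeodesicRay Lamplighter 1 :=
  ⟨⟨fun n => if 1 ≤ n then toggle (-1) * lampT ^ (-n : ℤ) else lampT ^ (-n : ℤ),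
    continuous_of_discreteTopology⟩,
    isometry_of_eventually_eq (F := fun m => litValley (m + 2))
      (Eventually.of_forall fun m => isometry_litValley (by omega)) eventually_litValley_eq,
    by simp⟩

theorem valleyRay_toBoundary (m : ℕ) :
    (valleyRay m).toBoundary = (litValleyRay m).toBoundary := by
  refine Quotient.sound ⟨4 * (m + 2), fun n => ?_⟩
  have h0 : (valleyRay m).1 0 = (litValleyRay m).1 0 :=
    (valleyRay m).2.2.trans (litValleyRay m).2.2.symm
  by_cases hn : n < 2 * (m + 2)
  · have h1 := dist_triangle ((valleyRay m).1 n) ((valleyRay m).1 0) ((litValleyRay m).1 n)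
    rw [(valleyRay m).2.1.dist_eq, h0, (litValleyRay m).2.1.dist_eq, dist_comm n, Nat.dist_eq,
      Nat.cast_zero, zero_sub, abs_neg, abs_of_nonneg (Nat.cast_nonneg n)] at h1
    have h2 : (n : ℝ) ≤ 2 * (m + 2) := by exact_mod_cast hn.le
    linarith
  · have h1 : (litValleyRay m).1 n = (valleyRay m).1 n := if_neg (by omega)
    rw [h1, dist_self]
    positivity

/-- The lamp at -1 differs, so the upper confluent stays at height 0 or above while both rays are at
height -n. -/
theorem le_dist_descent {n : ℕ} (hn : 1 ≤ n) : (n : ℝ) ≤ dist (descent.1 n) (litDescent.1 n) := by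
  have h1 : descent.1 n = lampT ^ (-n : ℤ) := rfl
  have h2 : litDescent.1 n = toggle (-1) * lampT ^ (-n : ℤ) := if_pos hn
  rw [h1, h2, dist_eq_treeDist]
  set x := lampT ^ (-n : ℤ) with hx
  set y := toggle (-1) * x with hy
  have hsx : state x = ⟨0, -n⟩ := state_lampT_zpow _
  have hsy : state y = ⟨Pi.single (-1) 1, -n⟩ := by
    rw [hy, map_mul, state_toggle, hsx]
    ext i <;> simp
  have l := lower_le x y
  have u : 0 ≤ upper x y := by
    by_contra hu
    have := (upper_le_iff.mp (show upper x y ≤ -1 by omega)).2.2 (-1) le_rfl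
    rw [hsx, hsy] at this
    simp at this
  rw [hsx] at l
  have : (n : ℤ) ≤ treeDist x y := by
    rw [treeDist, hsx, hsy]
    dsimp only at l ⊢
    omega
  exact_mod_cast this

theorem descent_toBoundary_ne : descent.toBoundary ≠ litDescent.toBoundary := by
  intro h
  obtain ⟨K, hK⟩ : ∃ K : ℝ, ∀ n : ℕ, dist (descent.1 n) (litDescent.1 n) ≤ K := Quotient.exact h
  obtain ⟨n, hn⟩ := exists_nat_gt K
  have h1 := hK (n + 1)
  have h2 := le_dist_descent (Nat.le_add_left 1 n)
  push_cast at h2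
  linarith

theorem not_t2Space_visualBoundary : ¬ T2Space (VisualBoundary Lamplighter 1) := by
  intro _
  have h1 : Tendsto (fun m => (valleyRay m).toBoundary) atTop (𝓝 descent.toBoundary) :=
    tendsto_toBoundary eventually_valley_eq
  have h2 : Tendsto (fun m => (litValleyRay m).toBoundary) atTop (𝓝 litDescent.toBoundary) :=
    tendsto_toBoundary eventually_litValley_eq
  simp only [← valleyRay_toBoundary] at h2
  exact descent_toBoundary_ne (tendsto_nhds_unique h1 h2)

end Lamplighter

/-- Sending an asymptotic class of geodesic rays to its Busemann function is a well-defined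
injection `∂_∞ L₂ → ∂_h L₂` which is not continuous; moreover `∂_∞ L₂` is not Hausdorff, while
`∂_h L₂` is. -/
theorem mainTheorem5 :
    (∃! β : VisualBoundary Lamplighter 1 → HorofunctionBoundary Lamplighter 1, IsBusemannMap β) ∧
    (∀ β : VisualBoundary Lamplighter 1 → HorofunctionBoundary Lamplighter 1, IsBusemannMap β →
      Function.Injective β ∧ ¬ Continuous β) ∧
    ¬ T2Space (VisualBoundary Lamplighter 1) ∧
    T2Space (HorofunctionBoundary Lamplighter 1) := by
  refine ⟨Lamplighter.horocyclicProduct.existsUnique_isBusemannMap 1, fun β hβ => ?_,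
    Lamplighter.not_t2Space_visualBoundary, inferInstance⟩
  have hinj := Lamplighter.horocyclicProduct.injective_of_isBusemannMap hβ
  exact ⟨hinj, fun hc =>
    Lamplighter.not_t2Space_visualBoundary (T2Space.of_injective_continuous hinj hc)⟩
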